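/- Let $k\ge 2$ and let $\phi_1,\dots,\phi_k:(0,\infty)\to(0,\infty)$ satisfy: (C1) each $\phi_i$ is $C^1$, increasing, and $\phi_i(x)\to\infty$ as $x\to\infty$; (C2) $\int_0^\infty e^{-c\phi_i(x)}\,dx<\infty$ for every $i$ and every $c>0$; (C3) there is $\kappa>1$ such that for each $1\le i\le k-1$, $\phi_i(x)^\kappa<\phi_{i+1}(x)$ for all sufficiently large $x$; (C4) there are $C,M>0$ such that $\frac1C\phi_i(x)^{-M}<\phi_i'(x)<C\phi_i(x)^M$ for all $x>C$ and all $i$. Let $\mathcal M_1$ be the set of Borel probability measures on $(0,\infty)$, and let $h(\mu)=-\int \frac{d\mu}{dx}\log\frac{d\mu}{dx}\,dx$ if $\mu\ll dx$ and $h(\mu)=-\infty$ otherwise. Let $\mathcal A_1\subset(0,\infty)^{k-1}$ be the interior of the set of $(v_1,\dots,v_{k-1})\in(0,\infty)^{k-1}$ for which there is $\mu\in\mathcal M_1$ with $h(\mu)\ne-\infty$, $\int\phi_i\,d\mu=v_i$ for $i\le k-1$ and $\int\phi_k\,d\mu<\infty$. For $v\in\mathcal A_1$ let $g_1(v)=\inf\{\int\phi_k\,d\mu:\mu\in\mathcal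 M_1,\ h(\mu)\neq-\infty,\ \int\phi_i\,d\mu=v_i\ (i\le k-1)\}$, and let $$\mathcal A=\{(v_1,\dots,v_k): (v_1,\dots,v_{k-1})\in\mathcal A_1,\ v_k>g_1(v_1,\dots,v_{k-1})\}.$$ Let $d\lambda=\frac{1}{Z}e^{-\phi_1}dx$ be the normalized probability measure on $(0,\infty)$, let $H(p_1,\dots,p_k)=\log\int e^{p_1\phi_1+\dots+p_k\phi_k}\,d\lambda\in(-\infty,\infty]$, and let $\partial H$ be its subdifferential. Write $\pi_1(v_1,\dots,v_k)=(v_1,\dots,v_{k-1})$ and $\pi_2(v_1,\dots,v_k)=v_k$. Let $\mathcal S_1$ be the set of $v\in\mathcal A_1$ such that $v\in\pi_1(\partial H(p_1,\dots,p_{k-1},0))$ for some $(p_1,\dots,p_{k-1})\in\mathbb R^{k-1}$ (which is then unique); for this $p$ put $g_2(v)=\inf\pi_2(\partial H(p_1,\dots,p_{k-1},0))$. Let $\mathcal S_2=\mathcal A_1\setminus\mathcal S_1$. Let $(a_1,\dots,a_k)\in\mathcal A$. Then $h$ has a unique maximizer $\lambda^*$ over $$\Big\{\mu\in\mathcal M_1:\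 \int\phi_i\,d\mu=a_i\ (1\le i\le k-1),\ \int\phi_k\,d\mu\le a_k\Big\},$$ and the following hold, where $Z<\infty$ denotes the normalizing constant. (1) If $(a_1,\dots,a_{k-1})\in\mathcal S_1$ and $a_k\ge g_2(a_1,\dots,a_{k-1})$, then there are $p_1,\dots,p_{k-1}\in\mathbb R$ with $$\lambda^*=\frac1Z e^{p_1\phi_1+\dots+p_{k-1}\phi_{k-1}}\,dx\quad\text{and}\quad \int\phi_i\,d\lambda^*=a_i\ \text{ for } 1\le i\le k-1.$$ (2) If $(a_1,\dots,a_{k-1})\in\mathcal S_2$, or $(a_1,\dots,a_{k-1})\in\mathcal S_1$ and $a_k<g_2(a_1,\dots,a_{k-1})$, then there are $p_1,\dots,p_k\in\mathbb R$ with $p_k<0$, $$\lambda^*=\frac1Z e^{p_1\phi_1+\dots+p_k\phi_k}\,dx\quad\text{and}\quad \int\phi_i\,d\lambda^*=a_i\ \text{ for } 1\le i\le k.$$ -/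

import Mathlib

open MeasureTheory Set Filter

noncomputable section

/-- The standing assumptions on the observables `φ₁, …, φₖ`, where `k = m + 1`; only the values
of `φ i` on `(0, ∞)` are used. -/
structure Observables {m : ℕ} (φ : Fin (m + 1) → ℝ → ℝ) : Prop where
  pos : ∀ i, ∀ x, 0 < x → 0 < φ i x
  contDiff : ∀ i, ContDiffOn ℝ 1 (φ i) (Ioi 0)
  mono : ∀ i, MonotoneOn (φ i) (Ioi 0)
  tendsto : ∀ i, Tendsto (φ i) atTop atTop
  integrable : ∀ i, ∀ c : ℝ, 0 < c → IntegrableOn (fun x => Real.exp (-c * φ i x)) (Ioi 0)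
  growth : ∃ κ : ℝ, 1 < κ ∧ ∀ i : Fin m, ∀ᶠ x in atTop, φ i.castSucc x ^ κ < φ i.succ x
  deriv_bound : ∃ C M : ℝ, 0 < C ∧ 0 < M ∧ ∀ i, ∀ x, C < x →
    1 / C * φ i x ^ (-M) < deriv (φ i) x ∧ deriv (φ i) x < C * φ i x ^ M

/-- Probability measures on `(0, ∞)`, as measures on `ℝ` that do not charge `(-∞, 0]`. -/
def IsProbOnPos (μ : Measure ℝ) : Prop :=
  IsProbabilityMeasure μ ∧ μ (Iic 0) = 0

/-- The integral of `f` against `μ` exists, is finite, and equals `v`. -/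
def HasMoment (μ : Measure ℝ) (f : ℝ → ℝ) (v : ℝ) : Prop :=
  Integrable f μ ∧ ∫ x, f x ∂μ = v

open Classical in
/-- The differential entropy `-∫ f log f dx` of `μ = f dx`, with values in `[-∞, ∞]`, as the
integral of the positive part of `-f log f` minus that of the negative part (`∞ - ∞ = -∞`);
it is `-∞` if `μ` is not absolutely continuous. -/
def diffEntropy (μ : Measure ℝ) : EReal :=
  if μ ≪ volume then
    ((∫⁻ x, ENNReal.ofReal (Real.negMulLog (μ.rnDeriv volume x).toReal) : ENNReal) : EReal) -
      ((∫⁻ x, ENNReal.ofReal (-Real.negMulLog (μ.rnDeriv volume x).toReal) : ENNReal) : EReal)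
  else ⊥

/-- The probability measure `Z⁻¹ e^{u(x)} dx` on `(0, ∞)`, for `u` with
`Z = ∫₀^∞ e^{u(x)} dx < ∞`. -/
def gibbs (u : ℝ → ℝ) : Measure ℝ :=
  (volume.restrict (Ioi 0)).tilted u

variable {m : ℕ}

/-- The set of moment vectors `(v₁, …, vₖ₋₁)` whose interior is `𝒜₁`. -/
def momentSet (φ : Fin (m + 1) → ℝ → ℝ) : Set (Fin m → ℝ) :=
  {v | (∀ i, 0 < v i) ∧ ∃ μ : Measure ℝ, IsProbOnPos μ ∧ diffEntropy μ ≠ ⊥ ∧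
    (∀ i : Fin m, HasMoment μ (φ i.castSucc) (v i)) ∧ Integrable (φ (Fin.last m)) μ}

/-- The set `𝒜₁`. -/
def admissible₁ (φ : Fin (m + 1) → ℝ → ℝ) : Set (Fin m → ℝ) :=
  interior (momentSet φ)

/-- The function `g₁`; for `v ∈ 𝒜₁` the infimum is over a nonempty set of positive reals. -/
def g₁ (φ : Fin (m + 1) → ℝ → ℝ) (v : Fin m → ℝ) : ℝ :=
  sInf {t | ∃ μ : Measure ℝ, IsProbOnPos μ ∧ diffEntropy μ ≠ ⊥ ∧
    (∀ i : Fin m, HasMoment μ (φ i.castSucc) (v i)) ∧ HasMoment μ (φ (Fin.last m)) t}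

/-- The admissible set `𝒜`. -/
def admissible (φ : Fin (m + 1) → ℝ → ℝ) : Set (Fin (m + 1) → ℝ) :=
  {v | Fin.init v ∈ admissible₁ φ ∧ g₁ φ (Fin.init v) < v (Fin.last m)}

/-- The reference probability measure `λ = Z⁻¹ e^{-φ₁} dx` on `(0, ∞)`. -/
def refMeasure (φ : Fin (m + 1) → ℝ → ℝ) : Measure ℝ :=
  gibbs (fun x => -φ 0 x)

/-- The logarithmic moment generating function `H(p) = log ∫ e^{p₁φ₁ + ⋯ + pₖφₖ} dλ`, with
values in `(-∞, ∞]`. -/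
def logMGF (φ : Fin (m + 1) → ℝ → ℝ) (p : Fin (m + 1) → ℝ) : EReal :=
  ENNReal.log (∫⁻ x, ENNReal.ofReal (Real.exp (∑ i, p i * φ i x)) ∂(refMeasure φ))

/-- The subdifferential at `p` of an extended-real-valued function on `ℝⁿ`. -/
def subdiff {n : ℕ} (F : (Fin n → ℝ) → EReal) (p : Fin n → ℝ) : Set (Fin n → ℝ) :=
  {v | ∀ q, F p + ((∑ i, v i * (q i - p i) : ℝ) : EReal) ≤ F q}

/-- The set `∂H(p₁, …, pₖ₋₁, 0)`. -/
def subdiff₀ (φ : Fin (m + 1) → ℝ → ℝ) (p : Fin m → ℝ) : Set (Fin (m + 1) → ℝ) :=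
  subdiff (logMGF φ) (Fin.snoc p 0)

/-- The set `𝒮₁`. -/
def S₁ (φ : Fin (m + 1) → ℝ → ℝ) : Set (Fin m → ℝ) :=
  {v | v ∈ admissible₁ φ ∧ ∃ p : Fin m → ℝ, v ∈ Fin.init '' subdiff₀ φ p}

/-- The set `𝒮₂`. -/
def S₂ (φ : Fin (m + 1) → ℝ → ℝ) : Set (Fin m → ℝ) :=
  admissible₁ φ ∩ (S₁ φ)ᶜ

open Classical in
/-- The function `g₂` on `𝒮₁`: the infimum of the last coordinate over `∂H(p₁, …, pₖ₋₁, 0)`, for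
the `p` with `v ∈ π₁(∂H(p₁, …, pₖ₋₁, 0))` (value `0` outside `𝒮₁`). -/
def g₂ (φ : Fin (m + 1) → ℝ → ℝ) (v : Fin m → ℝ) : ℝ :=
  if h : v ∈ S₁ φ then
    sInf ((fun w : Fin (m + 1) → ℝ => w (Fin.last m)) '' subdiff₀ φ (Classical.choose h.2))
  else 0

/-- The relaxed constraint set: `∫ φᵢ dμ = aᵢ` for `i < k` and `∫ φₖ dμ ≤ aₖ`. -/
def relaxedSet (φ : Fin (m + 1) → ℝ → ℝ) (a : Fin (m + 1) → ℝ) : Set (Measure ℝ) :=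
  {μ | IsProbOnPos μ ∧ (∀ i : Fin m, HasMoment μ (φ i.castSucc) (a i.castSucc)) ∧
    Integrable (φ (Fin.last m)) μ ∧ ∫ x, φ (Fin.last m) x ∂μ ≤ a (Fin.last m)}

/-- `μ` maximizes the differential entropy over the relaxed constraint set. -/
def IsEntropyMaximizer (φ : Fin (m + 1) → ℝ → ℝ) (a : Fin (m + 1) → ℝ) (μ : Measure ℝ) : Prop :=
  μ ∈ relaxedSet φ a ∧ ∀ ν ∈ relaxedSet φ a, diffEntropy ν ≤ diffEntropy μ

end

/-! The proof is convex duality. For q with qₖ ≤ 0 put D(q) = log ∫ e^{∑ qᵢφᵢ} - ∑ qᵢaᵢ. Gibbs'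
inequality gives h(μ) ≤ D(q) for every feasible μ, and equality forces μ to be the Gibbs measure of
q. So it suffices to minimize D and to show that the Gibbs measure of a minimizer p is feasible,
with pₖ(∫ φₖ - aₖ) = 0.

A minimizer exists (`exists_dualMin`): finite-entropy measures with moments around a, supplied by
the interior in 𝒜₁ and by g₁ < aₖ, bound a sublevel set of D, and Fatou's lemma gives lower
semicontinuity.

The first-order conditions are delicate at pₖ = 0, where ∫ e^{∑ qᵢφᵢ} may be infinite at nearby q.
Only directions e with pₖ + eₖ < 0 are used: there φₖ dominates and the integral converges, and a
one-sided derivative bound follows from Fatou (`integrable_and_le_integral_gibbs`). This yields the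
exact first k - 1 moments and ∫ φₖ ≤ aₖ, with equality if pₖ < 0.

Finally g₂ is the last moment of the Gibbs measure with pₖ = 0 and the prescribed first moments, so
a minimizer with pₖ = 0 exists exactly when (a₁, …, aₖ₋₁) ∈ 𝒮₁ and aₖ ≥ g₂. -/

noncomputable section

open scoped Topology ENNReal

variable {m : ℕ}

/-- Lebesgue measure on `(0, ∞)`. -/
abbrev posVol : Measure ℝ := volume.restrict (Ioi 0)

instance : NeZero posVol := ⟨by simp [posVol, Measure.restrict_eq_zero]⟩

/-! ### Entropy and the Gibbs variational principle -/

section Entropy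

/-- This is 1 + t < eᵗ at t = s - log y, multiplied by y. Its strictness is the source of uniqueness
of the maximizer. -/
theorem negMulLog_add_mul_lt {y s : ℝ} (hy : 0 ≤ y) (h : y ≠ Real.exp s) :
    Real.negMulLog y + y * s < Real.exp s - y := by
  rcases hy.eq_or_lt with rfl | hy
  · simpa using Real.exp_pos s
  · have hne : s - Real.log y ≠ 0 := fun h0 =>
      h (by rw [sub_eq_zero.1 h0, Real.exp_log hy])
    have h1 := Real.add_one_lt_exp hne
    rw [Real.exp_sub, Real.exp_log hy, lt_div_iff₀ hy] at h1
    unfold Real.negMulLog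
    nlinarith

theorem negMulLog_add_mul_le {y s : ℝ} (hy : 0 ≤ y) :
    Real.negMulLog y + y * s ≤ Real.exp s - y := by
  by_cases h : y = Real.exp s
  · subst h
    simp only [Real.negMulLog, Real.log_exp]
    linarith
  · exact (negMulLog_add_mul_lt hy h).le

theorem diffEntropy_withDensity_eq_sub {f : ℝ → ℝ≥0∞} (hf : AEMeasurable f posVol) :
    diffEntropy (posVol.withDensity f) =
      ((∫⁻ x, ENNReal.ofReal (Real.negMulLog (f x).toReal) ∂posVol : ℝ≥0∞) : EReal) -
      ((∫⁻ x, ENNReal.ofReal (-Real.negMulLog (f x).toReal) ∂posVol : ℝ≥0∞) : EReal) := by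
  have hac : posVol.withDensity f ≪ volume :=
    (withDensity_absolutelyContinuous _ _).trans Measure.restrict_le_self.absolutelyContinuous
  have hrn : (posVol.withDensity f).rnDeriv volume =ᵐ[volume] (Ioi 0).indicator f := by
    rw [← withDensity_indicator measurableSet_Ioi]
    exact Measure.rnDeriv_withDensity₀ _ ((aemeasurable_indicator_iff measurableSet_Ioi).2 hf)
  have key : ∀ F : ℝ → ℝ≥0∞, F 0 = 0 →
      ∫⁻ x, F ((posVol.withDensity f).rnDeriv volume x).toReal =
        ∫⁻ x, F (f x).toReal ∂posVol := by
    intro F hF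
    rw [← lintegral_indicator measurableSet_Ioi]
    refine lintegral_congr_ae ?_
    filter_upwards [hrn] with x hx
    rw [hx]
    by_cases h : x ∈ Ioi (0 : ℝ) <;> simp [h, hF]
  rw [diffEntropy, if_pos hac,
    key (fun y => ENNReal.ofReal (Real.negMulLog y)) (by simp),
    key (fun y => ENNReal.ofReal (-Real.negMulLog y)) (by simp)]

theorem diffEntropy_withDensity {f : ℝ → ℝ≥0∞} (hf : AEMeasurable f posVol)
    (hi : Integrable (fun x => Real.negMulLog (f x).toReal) posVol) :
    diffEntropy (posVol.withDensity f) =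
      ((∫ x, Real.negMulLog (f x).toReal ∂posVol : ℝ) : EReal) := by
  rw [diffEntropy_withDensity_eq_sub hf, integral_eq_lintegral_pos_part_sub_lintegral_neg_part hi,
    EReal.coe_sub, EReal.coe_ennreal_toReal hi.lintegral_lt_top.ne,
    EReal.coe_ennreal_toReal]
  exact hi.neg.lintegral_lt_top.ne

theorem IsProbOnPos.exists_density {μ : Measure ℝ} (hμ : IsProbOnPos μ) (hac : μ ≪ volume) :
    ∃ f : ℝ → ℝ≥0∞, Measurable f ∧ (∀ᵐ x ∂posVol, f x < ∞) ∧ μ = posVol.withDensity f := by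
  have := hμ.1
  refine ⟨μ.rnDeriv volume, Measure.measurable_rnDeriv _ _,
    ae_restrict_of_ae (Measure.rnDeriv_lt_top _ _), ?_⟩
  rw [← restrict_withDensity measurableSet_Ioi, Measure.withDensity_rnDeriv_eq _ _ hac]
  refine (Measure.restrict_eq_self_of_ae_mem ?_).symm
  rw [ae_iff]
  simpa [← Iic_def] using hμ.2

/-- A measure of finite entropy, with its density. -/
theorem exists_density_of_diffEntropy_ne_bot {μ : Measure ℝ} (hμ : IsProbOnPos μ)
    (h : diffEntropy μ ≠ ⊥) {u : ℝ → ℝ} (hu : Integrable u μ)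
    (hexp : Integrable (fun x => Real.exp (u x)) posVol) :
    ∃ f : ℝ → ℝ≥0∞, Measurable f ∧ (∀ᵐ x ∂posVol, f x < ∞) ∧ μ = posVol.withDensity f ∧
      Integrable (fun x => Real.negMulLog (f x).toReal) posVol ∧
      diffEntropy μ = ((∫ x, Real.negMulLog (f x).toReal ∂posVol : ℝ) : EReal) := by
  have hac : μ ≪ volume := by
    by_contra hac
    exact h (by rw [diffEntropy, if_neg hac])
  obtain ⟨f, hf, hfin, rfl⟩ := hμ.exists_density hac
  refine ⟨f, hf, hfin, rfl, ?_⟩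
  have := hμ.1
  rw [integrable_withDensity_iff hf hfin] at hu
  have hmeas : Measurable fun x => Real.negMulLog (f x).toReal :=
    Real.continuous_negMulLog.measurable.comp hf.ennreal_toReal
  -- An infinite negative part gives entropy `⊥` even against an infinite positive part, by the
  -- convention ∞ - ∞ = -∞.
  have hneg : ∫⁻ x, ENNReal.ofReal (-Real.negMulLog (f x).toReal) ∂posVol ≠ ∞ := by
    intro h0
    apply h
    rw [diffEntropy_withDensity_eq_sub hf.aemeasurable, h0]
    simp [sub_eq_add_neg]
  -- Pointwise -f log f ≤ e^u - u f, and the right side is integrable.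
  have hpos : ∫⁻ x, ENNReal.ofReal (Real.negMulLog (f x).toReal) ∂posVol ≠ ∞ := by
    refine ((lintegral_mono fun x => ENNReal.ofReal_le_ofReal ?_).trans_lt
      (hexp.sub hu).lintegral_lt_top).ne
    have := negMulLog_add_mul_le (y := (f x).toReal) (s := u x) ENNReal.toReal_nonneg
    have h0 : 0 ≤ (f x).toReal := ENNReal.toReal_nonneg
    simp only [Pi.sub_apply]
    linarith
  have hi : Integrable (fun x => Real.negMulLog (f x).toReal) posVol := by
    refine ⟨hmeas.aestronglyMeasurable, ?_⟩
    rw [hasFiniteIntegral_iff_norm]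
    refine lt_of_le_of_lt ?_ (ENNReal.add_lt_top.2 ⟨hpos.lt_top, hneg.lt_top⟩)
    rw [← lintegral_add_left hmeas.ennreal_ofReal]
    refine lintegral_mono fun x => ?_
    rw [Real.norm_eq_abs]
    rcases le_total 0 (Real.negMulLog (f x).toReal) with h0 | h0
    · simp [abs_of_nonneg h0]
    · simp [abs_of_nonpos h0]
  exact ⟨hi, diffEntropy_withDensity hf.aemeasurable hi⟩

theorem exp_sub_log_integral {u : ℝ → ℝ} (hexp : Integrable (fun x => Real.exp (u x)) posVol)
    (x : ℝ) : Real.exp (u x - Real.log (∫ y, Real.exp (u y) ∂posVol)) =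
      Real.exp (u x) / ∫ y, Real.exp (u y) ∂posVol := by
  rw [Real.exp_sub, Real.exp_log (integral_exp_pos hexp)]

theorem gibbs_eq_withDensity {u : ℝ → ℝ} (hexp : Integrable (fun x => Real.exp (u x)) posVol) :
    gibbs u = posVol.withDensity fun x =>
      ENNReal.ofReal (Real.exp (u x - Real.log (∫ y, Real.exp (u y) ∂posVol))) := by
  simp only [exp_sub_log_integral hexp]
  rfl

/-- The Gibbs inequality, with its equality case. -/
theorem gibbs_inequality {μ : Measure ℝ} (hμ : IsProbOnPos μ) {f : ℝ → ℝ≥0∞}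
    (hf : Measurable f) (hfin : ∀ᵐ x ∂posVol, f x < ∞) (hμf : μ = posVol.withDensity f)
    (hi : Integrable (fun x => Real.negMulLog (f x).toReal) posVol)
    {u : ℝ → ℝ} (hu : Integrable u μ) (hexp : Integrable (fun x => Real.exp (u x)) posVol) :
    (∫ x, Real.negMulLog (f x).toReal ∂posVol) + ∫ x, u x ∂μ
        ≤ Real.log (∫ x, Real.exp (u x) ∂posVol) ∧
      ((∫ x, Real.negMulLog (f x).toReal ∂posVol) + ∫ x, u x ∂μ
        = Real.log (∫ x, Real.exp (u x) ∂posVol) → μ = gibbs u) := by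
  subst hμf
  have := hμ.1
  set L := Real.log (∫ x, Real.exp (u x) ∂posVol) with hL
  have hone := integrable_const (μ := posVol.withDensity f) (1 : ℝ)
  rw [integrable_withDensity_iff hf hfin] at hu hone
  simp only [one_mul] at hone
  have hmass : ∫ x, (f x).toReal ∂posVol = 1 := by
    have := integral_withDensity_eq_integral_toReal_smul hf hfin (fun _ => (1 : ℝ))
    simpa using this.symm
  have humass : ∫ x, u x ∂(posVol.withDensity f) = ∫ x, u x * (f x).toReal ∂posVol := by
    rw [integral_withDensity_eq_integral_toReal_smul hf hfin]
    simp [mul_comm]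
  have hg : Integrable (fun x => Real.exp (u x - L)) posVol := by
    simp only [hL, exp_sub_log_integral hexp]
    exact hexp.div_const _
  have hgmass : ∫ x, Real.exp (u x - L) ∂posVol = 1 := by
    simp only [hL, exp_sub_log_integral hexp]
    rw [integral_div, div_self (integral_exp_pos hexp).ne']
  -- The pointwise gap between f and the normalized density e^{u - L}; its integral is the defect in
  -- the Gibbs inequality, so equality makes it vanish almost everywhere.
  let D : ℝ → ℝ := fun x => (Real.exp (u x - L) - (f x).toReal) -
    (Real.negMulLog (f x).toReal + (u x * (f x).toReal - L * (f x).toReal))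
  have hDi : Integrable D posVol := (hg.sub hone).sub (hi.add (hu.sub (hone.const_mul L)))
  have hD0 : ∀ x, 0 ≤ D x := fun x => by
    have := negMulLog_add_mul_le (y := (f x).toReal) (s := u x - L) ENNReal.toReal_nonneg
    simp only [D]
    linarith
  have hDint : ∫ x, D x ∂posVol =
      L - ((∫ x, Real.negMulLog (f x).toReal ∂posVol) + ∫ x, u x ∂(posVol.withDensity f)) := by
    have e1 : ∫ x, D x ∂posVol = _ := integral_sub (hg.sub hone) (hi.add (hu.sub (hone.const_mul L)))
    have e2 := integral_sub hg hone
    have e3 := integral_add hi (hu.sub (hone.const_mul L))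
    have e4 := integral_sub hu (hone.const_mul L)
    simp only [Pi.sub_apply] at e1 e2 e3 e4
    rw [e1, e2, e3, e4, integral_const_mul, hmass, hgmass, humass]
    ring
  have hnn := integral_nonneg (μ := posVol) (f := D) hD0
  refine ⟨by linarith, fun heq => ?_⟩
  have hz : ∫ x, D x ∂posVol = 0 := by rw [hDint, heq, sub_self]
  rw [integral_eq_zero_iff_of_nonneg (f := D) hD0 hDi] at hz
  rw [gibbs_eq_withDensity hexp]
  refine withDensity_congr_ae ?_
  filter_upwards [hz, hfin] with x hx hfx
  have : (f x).toReal = Real.exp (u x - L) := by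
    by_contra hne
    have := negMulLog_add_mul_lt ENNReal.toReal_nonneg hne
    simp only [D, Pi.zero_apply] at hx
    linarith
  rw [← hL, ← this, ENNReal.ofReal_toReal hfx.ne]

theorem isProbOnPos_gibbs {u : ℝ → ℝ} (hexp : Integrable (fun x => Real.exp (u x)) posVol) :
    IsProbOnPos (gibbs u) :=
  ⟨isProbabilityMeasure_tilted hexp, tilted_absolutelyContinuous _ _ (by
    rw [Measure.restrict_apply measurableSet_Iic, Iic_inter_Ioi, Ioc_self, measure_empty])⟩

theorem aemeasurable_of_integrable_exp {u : ℝ → ℝ}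
    (hexp : Integrable (fun x => Real.exp (u x)) posVol) : AEMeasurable u posVol := by
  simpa using hexp.aemeasurable.log

theorem integral_gibbs (u w : ℝ → ℝ) :
    ∫ x, w x ∂(gibbs u) =
      (∫ x, Real.exp (u x) * w x ∂posVol) / ∫ x, Real.exp (u x) ∂posVol := by
  rw [gibbs, integral_tilted, ← integral_div]
  congr with x
  rw [smul_eq_mul]
  ring

theorem integrable_gibbs_iff {u : ℝ → ℝ} (hexp : Integrable (fun x => Real.exp (u x)) posVol)
    (w : ℝ → ℝ) :
    Integrable w (gibbs u) ↔ Integrable (fun x => Real.exp (u x) * w x) posVol := by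
  rw [gibbs, integrable_tilted_iff hexp]
  simp only [smul_eq_mul]

theorem gibbs_density {u : ℝ → ℝ} (hexp : Integrable (fun x => Real.exp (u x)) posVol)
    (hu : Integrable u (gibbs u)) :
    ∃ f : ℝ → ℝ≥0∞, AEMeasurable f posVol ∧ gibbs u = posVol.withDensity f ∧
      Integrable (fun x => Real.negMulLog (f x).toReal) posVol ∧
      ∫ x, Real.negMulLog (f x).toReal ∂posVol =
        Real.log (∫ x, Real.exp (u x) ∂posVol) - ∫ x, u x ∂(gibbs u) := by
  have hpos := integral_exp_pos hexp
  refine ⟨_, ?_, gibbs_eq_withDensity hexp, ?_⟩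
  · exact ((aemeasurable_of_integrable_exp hexp).sub_const _).exp.ennreal_ofReal
  rw [integral_gibbs]
  rw [integrable_gibbs_iff hexp] at hu
  set L := Real.log (∫ x, Real.exp (u x) ∂posVol) with hL
  have hfun : (fun x => Real.negMulLog (ENNReal.ofReal (Real.exp (u x - L))).toReal) =
      fun x => (L * Real.exp (u x) - Real.exp (u x) * u x) / ∫ y, Real.exp (u y) ∂posVol := by
    ext x
    rw [ENNReal.toReal_ofReal (Real.exp_pos _).le, Real.negMulLog, Real.log_exp, hL,
      exp_sub_log_integral hexp]
    ring
  rw [hfun]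
  refine ⟨((hexp.const_mul L).sub hu).div_const _, ?_⟩
  rw [integral_div, integral_sub (hexp.const_mul L) hu, integral_const_mul]
  field_simp

theorem diffEntropy_gibbs {u : ℝ → ℝ} (hexp : Integrable (fun x => Real.exp (u x)) posVol)
    (hu : Integrable u (gibbs u)) :
    diffEntropy (gibbs u) =
      ((Real.log (∫ x, Real.exp (u x) ∂posVol) - ∫ x, u x ∂(gibbs u) : ℝ) : EReal) := by
  obtain ⟨f, hf, hμ, hi, hint⟩ := gibbs_density hexp hu
  rw [← hint, ← diffEntropy_withDensity hf hi, hμ]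

/-- The Gibbs variational principle: `h(μ) + ∫ u dμ ≤ log ∫ e^u`, with equality only at the
Gibbs measure. -/
theorem gibbs_variational {μ : Measure ℝ} (hμ : IsProbOnPos μ) (h : diffEntropy μ ≠ ⊥)
    {u₀ : ℝ → ℝ} (hu₀ : Integrable u₀ μ)
    (hexp₀ : Integrable (fun x => Real.exp (u₀ x)) posVol) :
    ∃ e : ℝ, diffEntropy μ = e ∧ ∀ u : ℝ → ℝ, Integrable u μ →
      Integrable (fun x => Real.exp (u x)) posVol →
      e + ∫ x, u x ∂μ ≤ Real.log (∫ x, Real.exp (u x) ∂posVol) ∧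
      (e + ∫ x, u x ∂μ = Real.log (∫ x, Real.exp (u x) ∂posVol) → μ = gibbs u) := by
  obtain ⟨f, hf, hfin, hμf, hi, he⟩ := exists_density_of_diffEntropy_ne_bot hμ h hu₀ hexp₀
  exact ⟨_, he, fun u hu hexp => gibbs_inequality hμ hf hfin hμf hi hu hexp⟩

/-- If `log ∫ e^{u + t w}` grows at least like `t c` for `t ∈ [0, 1]`, then `∫ w ≥ c` under the
Gibbs measure of `u`. -/
theorem integrable_and_le_integral_gibbs {u w : ℝ → ℝ} {c : ℝ}
    (hu : Integrable (fun x => Real.exp (u x)) posVol)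
    (huw : Integrable (fun x => Real.exp (u x + w x)) posVol)
    (h : ∀ t : ℝ, 0 < t → t ≤ 1 → Integrable (fun x => Real.exp (u x + t * w x)) posVol →
      Real.log (∫ x, Real.exp (u x) ∂posVol) + t * c
        ≤ Real.log (∫ x, Real.exp (u x + t * w x) ∂posVol)) :
    Integrable w (gibbs u) ∧ c ≤ ∫ x, w x ∂(gibbs u) := by
  have hmu := aemeasurable_of_integrable_exp hu
  have hmw : AEMeasurable w posVol := by
    refine ((aemeasurable_of_integrable_exp huw).sub hmu).congr (ae_of_all _ fun x => ?_)
    simp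
  set Z := ∫ x, Real.exp (u x) ∂posVol with hZ
  have hZpos : 0 < Z := integral_exp_pos hu
  have hconv : ∀ x t : ℝ, 0 ≤ t → t ≤ 1 →
      Real.exp (u x + t * w x) ≤ (1 - t) * Real.exp (u x) + t * Real.exp (u x + w x) := by
    intro x t h0 h1
    have := convexOn_exp.2 (mem_univ (u x)) (mem_univ (u x + w x)) (sub_nonneg.2 h1) h0 (by ring)
    simp only [smul_eq_mul] at this
    refine le_trans (le_of_eq ?_) this
    ring_nf
  have hit : ∀ t : ℝ, 0 ≤ t → t ≤ 1 → Integrable (fun x => Real.exp (u x + t * w x)) posVol := by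
    intro t h0 h1
    refine ((hu.const_mul (1 - t)).add (huw.const_mul t)).mono'
      (hmu.add (hmw.const_mul t)).exp.aestronglyMeasurable (ae_of_all _ fun x => ?_)
    rw [Real.norm_eq_abs, abs_of_pos (Real.exp_pos _)]
    exact hconv x t h0 h1
  -- By convexity of exp the chord slope on [0, 1] exceeds the one on [0, t]. The nonnegative gap
  -- allows Fatou as t ↓ 0, with no prior integrability of e^u w.
  let ψ : ℝ → ℝ → ℝ := fun t x => (Real.exp (u x + w x) - Real.exp (u x)) -
    (Real.exp (u x + t * w x) - Real.exp (u x)) / t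
  have hψm : ∀ t, AEMeasurable (ψ t) posVol := fun t =>
    ((hmu.add hmw).exp.sub hmu.exp).sub
      (((hmu.add (hmw.const_mul t)).exp.sub hmu.exp).div_const t)
  have hψ0 : ∀ t, 0 < t → t ≤ 1 → ∀ x, 0 ≤ ψ t x := by
    intro t h0 h1 x
    have := hconv x t h0.le h1
    simp only [ψ, sub_nonneg]
    rw [div_le_iff₀ h0]
    linarith
  have hψint : ∀ t, 0 < t → t ≤ 1 → ∫⁻ x, ENNReal.ofReal (ψ t x) ∂posVol ≤
      ENNReal.ofReal ((∫ x, Real.exp (u x + w x) ∂posVol) - Z - Z * c) := by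
    intro t h0 h1
    have hti := hit t h0.le h1
    have hi : Integrable (ψ t) posVol := (huw.sub hu).sub ((hti.sub hu).div_const t)
    rw [← ofReal_integral_eq_lintegral_ofReal hi (ae_of_all _ (hψ0 t h0 h1))]
    refine ENNReal.ofReal_le_ofReal ?_
    have e1 : ∫ x, ψ t x ∂posVol = _ := integral_sub (huw.sub hu) ((hti.sub hu).div_const t)
    have e2 := integral_sub huw hu
    have e3 := integral_sub hti hu
    rw [e1, e2, integral_div, e3]
    have h2 := h t h0 h1 hti
    rw [Real.le_log_iff_exp_le (integral_exp_pos hti), Real.exp_add, Real.exp_log hZpos] at h2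
    -- Exponentiating the hypothesis gives Z e^{tc} ≤ ∫ e^{u + tw}, and e^{tc} ≥ 1 + tc makes this
    -- linear in t.
    have h3 := Real.add_one_le_exp (t * c)
    have h4 : Z * c ≤ ((∫ x, Real.exp (u x + t * w x) ∂posVol) - Z) / t := by
      rw [le_div_iff₀ h0]
      nlinarith [mul_le_mul_of_nonneg_left h3 hZpos.le]
    linarith
  let ψ₀ : ℝ → ℝ := fun x => (Real.exp (u x + w x) - Real.exp (u x)) - Real.exp (u x) * w x
  have hψ₀0 : ∀ x, 0 ≤ ψ₀ x := by
    intro x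
    have := Real.add_one_le_exp (w x)
    simp only [ψ₀, Real.exp_add]
    nlinarith [Real.exp_pos (u x)]
  have hψ₀m : AEMeasurable ψ₀ posVol := ((hmu.add hmw).exp.sub hmu.exp).sub (hmu.exp.mul hmw)
  let t : ℕ → ℝ := fun n => 1 / ((n : ℝ) + 1)
  have ht0 : ∀ n, 0 < t n := fun n => Nat.one_div_pos_of_nat
  have ht1 : ∀ n, t n ≤ 1 := fun n => by
    simp only [t]
    rw [div_le_one (by positivity)]
    linarith [n.cast_nonneg (α := ℝ)]
  have htlim : Tendsto t atTop (𝓝[≠] 0) :=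
    tendsto_nhdsWithin_iff.2 ⟨tendsto_one_div_add_atTop_nhds_zero_nat,
      Eventually.of_forall fun n => (ht0 n).ne'⟩
  have hlim : ∀ x, Tendsto (fun n => ψ (t n) x) atTop (𝓝 (ψ₀ x)) := by
    intro x
    have hd : HasDerivAt (fun s : ℝ => Real.exp (u x + s * w x)) (Real.exp (u x) * w x) 0 := by
      have := (((hasDerivAt_id (0 : ℝ)).mul_const (w x)).const_add (u x)).exp
      simpa using this
    have := hd.tendsto_slope_zero.comp htlim
    refine Tendsto.const_sub _ (this.congr fun n => ?_)
    simp only [Function.comp_apply, zero_add, zero_mul, add_zero, smul_eq_mul]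
    rw [div_eq_inv_mul]
  have hfatou : ∫⁻ x, ENNReal.ofReal (ψ₀ x) ∂posVol ≤
      ENNReal.ofReal ((∫ x, Real.exp (u x + w x) ∂posVol) - Z - Z * c) := by
    calc ∫⁻ x, ENNReal.ofReal (ψ₀ x) ∂posVol
        = ∫⁻ x, liminf (fun n => ENNReal.ofReal (ψ (t n) x)) atTop ∂posVol := by
          refine lintegral_congr fun x => ?_
          exact ((ENNReal.continuous_ofReal.tendsto _).comp (hlim x)).liminf_eq.symm
      _ ≤ liminf (fun n => ∫⁻ x, ENNReal.ofReal (ψ (t n) x) ∂posVol) atTop :=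
          lintegral_liminf_le' fun n => (hψm _).ennreal_ofReal
      _ ≤ _ := liminf_le_of_le (by isBoundedDefault) fun b hb => by
          obtain ⟨n, hn⟩ := hb.exists
          exact hn.trans (hψint _ (ht0 n) (ht1 n))
  have hψ₀i : Integrable ψ₀ posVol := by
    refine ⟨hψ₀m.aestronglyMeasurable, ?_⟩
    rw [hasFiniteIntegral_iff_ofReal (ae_of_all _ hψ₀0)]
    exact hfatou.trans_lt ENNReal.ofReal_lt_top
  have hwi : Integrable (fun x => Real.exp (u x) * w x) posVol :=
    ((huw.sub hu).sub hψ₀i).congr (ae_of_all _ fun x => by simp only [ψ₀, Pi.sub_apply]; ring)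
  refine ⟨(integrable_gibbs_iff hu w).2 hwi, ?_⟩
  rw [integral_gibbs, le_div_iff₀ hZpos]
  -- The case t = 1 shows that `ENNReal.ofReal` did not truncate the Fatou bound.
  have hnn : 0 ≤ (∫ x, Real.exp (u x + w x) ∂posVol) - Z - Z * c := by
    have h1 := h 1 one_pos le_rfl (by simpa using huw)
    simp only [one_mul] at h1
    rw [Real.le_log_iff_exp_le (integral_exp_pos huw), Real.exp_add, Real.exp_log hZpos] at h1
    nlinarith [mul_le_mul_of_nonneg_left (Real.add_one_le_exp c) hZpos.le]
  rw [← ofReal_integral_eq_lintegral_ofReal hψ₀i (ae_of_all _ hψ₀0),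
    ENNReal.ofReal_le_ofReal_iff hnn] at hfatou
  have e1 : ∫ x, ψ₀ x ∂posVol = _ := integral_sub (huw.sub hu) hwi
  have e2 := integral_sub huw hu
  rw [e1, e2] at hfatou
  linarith

end Entropy

/-! ### Linear combinations of the observables -/

/-- The linear combination `∑ qᵢ φᵢ`. -/
def linComb {n : ℕ} (φ : Fin n → ℝ → ℝ) (q : Fin n → ℝ) (x : ℝ) : ℝ := ∑ i, q i * φ i x

theorem linComb_add {n : ℕ} (φ : Fin n → ℝ → ℝ) (p q : Fin n → ℝ) (x : ℝ) :
    linComb φ (p + q) x = linComb φ p x + linComb φ q x := by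
  simp [linComb, add_mul, Finset.sum_add_distrib]

theorem linComb_smul {n : ℕ} (φ : Fin n → ℝ → ℝ) (t : ℝ) (q : Fin n → ℝ) (x : ℝ) :
    linComb φ (t • q) x = t * linComb φ q x := by
  simp [linComb, mul_assoc, Finset.mul_sum]

theorem linComb_single {n : ℕ} (φ : Fin n → ℝ → ℝ) (i : Fin n) (s : ℝ) (x : ℝ) :
    linComb φ (Pi.single i s) x = s * φ i x := by
  simp [linComb, Pi.single_apply]

section LinComb

variable {n : ℕ} {φ : Fin n → ℝ → ℝ} {μ : Measure ℝ}

theorem integrable_linComb (h : ∀ i, Integrable (φ i) μ) (q : Fin n → ℝ) :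
    Integrable (linComb φ q) μ :=
  integrable_finsetSum _ fun i _ => (h i).const_mul _

theorem integral_linComb (h : ∀ i, Integrable (φ i) μ) (q : Fin n → ℝ) :
    ∫ x, linComb φ q x ∂μ = ∑ i, q i * ∫ x, φ i x ∂μ := by
  simp only [linComb]
  rw [integral_finsetSum _ fun i _ => (h i).const_mul _]
  simp only [integral_const_mul]

end LinComb

namespace Observables

variable {φ : Fin (m + 1) → ℝ → ℝ}

theorem aemeasurable (hφ : Observables φ) (i : Fin (m + 1)) : AEMeasurable (φ i) posVol :=
  (hφ.contDiff i).continuousOn.aemeasurable measurableSet_Ioi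

theorem aemeasurable_linComb (hφ : Observables φ) (q : Fin (m + 1) → ℝ) :
    AEMeasurable (linComb φ q) posVol := by
  unfold linComb
  exact Finset.aemeasurable_fun_sum _ fun i _ => (hφ.aemeasurable i).const_mul _

/-- Since y = o(y^κ) for κ > 1, condition (C3) makes each observable negligible against the next;
chain these. -/
theorem isLittleO_of_lt (hφ : Observables φ) (j : Fin (m + 1)) :
    ∀ i, i < j → φ i =o[atTop] φ j := by
  obtain ⟨κ, hκ, hg⟩ := hφ.growth
  have step : ∀ i : Fin m, φ i.castSucc =o[atTop] φ i.succ := by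
    intro i
    have h1 : (fun x : ℝ => x) =o[atTop] fun x : ℝ => x ^ κ := by
      refine Asymptotics.isLittleO_of_tendsto' ?_ ?_
      · filter_upwards [eventually_gt_atTop 0] with x hx h0
        exact absurd h0 (Real.rpow_pos_of_pos hx κ).ne'
      · refine (tendsto_rpow_neg_atTop (sub_pos.2 hκ)).congr' ?_
        filter_upwards [eventually_gt_atTop 0] with x hx
        rw [neg_sub, Real.rpow_sub hx, Real.rpow_one]
    refine (h1.comp_tendsto (hφ.tendsto i.castSucc)).trans_isBigO ?_
    refine Asymptotics.IsBigO.of_bound 1 ?_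
    filter_upwards [hg i, eventually_gt_atTop 0] with x hx hx0
    have := Real.rpow_pos_of_pos (hφ.pos i.castSucc x hx0) κ
    simp only [Function.comp_apply, Real.norm_eq_abs, one_mul]
    rw [abs_of_pos this, abs_of_pos (hφ.pos _ x hx0)]
    exact hx.le
  induction j using Fin.induction with
  | zero => exact fun i hi => absurd hi (Fin.not_lt_zero i)
  | succ j ih =>
    intro i hi
    rcases (Fin.le_castSucc_iff.2 hi).eq_or_lt with rfl | hlt
    · exact step j
    · exact (ih i hlt).trans (step j)

theorem integrable_exp_linComb (hφ : Observables φ) {q : Fin (m + 1) → ℝ}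
    (hq : q (Fin.last m) < 0) : Integrable (fun x => Real.exp (linComb φ q x)) posVol := by
  -- Half of the decay of the last term absorbs the lower ones at infinity; the other half is left
  -- for (C2). Near 0 monotonicity bounds every φᵢ by its value at X.
  set c := -(q (Fin.last m)) / 2 with hc
  have hc0 : 0 < c := by rw [hc]; linarith
  have hlo : (fun x => ∑ i : Fin m, q i.castSucc * φ i.castSucc x) =o[atTop] φ (Fin.last m) :=
    Asymptotics.IsLittleO.fun_sum fun i _ =>
      (hφ.isLittleO_of_lt _ _ (Fin.castSucc_lt_last i)).const_mul_left _
  obtain ⟨X, hX⟩ := eventually_atTop.1 ((hlo.bound hc0).and (eventually_gt_atTop 0))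
  have hX0 : 0 < X := (hX X le_rfl).2
  set B := Real.exp (∑ i, |q i| * φ i X) with hB
  have hdom : Integrable (fun x => (Ioc 0 X).indicator (fun _ => B) x +
      Real.exp (-c * φ (Fin.last m) x)) posVol := by
    refine Integrable.add ?_ (hφ.integrable (Fin.last m) c hc0)
    rw [integrable_indicator_iff measurableSet_Ioc]
    refine integrableOn_const ?_
    exact ((Measure.restrict_apply_le _ _).trans_lt measure_Ioc_lt_top).ne
  refine hdom.mono' (hφ.aemeasurable_linComb q).exp.aestronglyMeasurable ?_
  filter_upwards [ae_restrict_mem measurableSet_Ioi] with x (hx : 0 < x)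
  rw [Real.norm_eq_abs, abs_of_pos (Real.exp_pos _)]
  rcases le_total x X with hxX | hxX
  · have hmem : x ∈ Ioc 0 X := ⟨hx, hxX⟩
    rw [indicator_of_mem hmem]
    refine le_trans (Real.exp_le_exp.2 (Finset.sum_le_sum fun i _ => ?_))
      (le_add_of_nonneg_right (Real.exp_pos _).le)
    exact mul_le_mul (le_abs_self _) (hφ.mono i hx hX0 hxX) (hφ.pos i x hx).le (abs_nonneg _)
  · refine le_trans (Real.exp_le_exp.2 ?_)
      (le_add_of_nonneg_left (indicator_nonneg (fun _ _ => (Real.exp_pos _).le) _))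
    have h1 := (hX x hxX).1
    rw [Real.norm_eq_abs, Real.norm_eq_abs, abs_of_pos (hφ.pos _ x hx)] at h1
    have h2 := (le_abs_self _).trans h1
    simp only [linComb]
    rw [Fin.sum_univ_castSucc]
    have : q (Fin.last m) = -2 * c := by rw [hc]; ring
    rw [this]
    linarith

/-- The Gibbs variational principle for linear combinations of the observables. -/
theorem variational (hφ : Observables φ) {μ : Measure ℝ} (hμ : IsProbOnPos μ)
    (h : diffEntropy μ ≠ ⊥) (hi : ∀ i, Integrable (φ i) μ) :
    ∃ e : ℝ, diffEntropy μ = e ∧ ∀ q : Fin (m + 1) → ℝ,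
      Integrable (fun x => Real.exp (linComb φ q x)) posVol →
      e + ∑ i, q i * ∫ x, φ i x ∂μ ≤ Real.log (∫ x, Real.exp (linComb φ q x) ∂posVol) ∧
      (e + ∑ i, q i * ∫ x, φ i x ∂μ = Real.log (∫ x, Real.exp (linComb φ q x) ∂posVol) →
        μ = gibbs (linComb φ q)) := by
  have h0 := integrable_linComb hi (Pi.single (Fin.last m) (-1))
  obtain ⟨e, he, H⟩ := gibbs_variational hμ h h0 (hφ.integrable_exp_linComb (by simp))
  refine ⟨e, he, fun q hq => ?_⟩
  rw [← integral_linComb hi]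
  exact H _ (integrable_linComb hi q) hq

end Observables

/-! ### First-order conditions at a dual minimizer -/

/-- `p` minimizes the dual function `q ↦ log ∫ e^{∑ qᵢ φᵢ} - ∑ qᵢ vᵢ` over `{qₖ ≤ 0}`. -/
structure IsDualMin (φ : Fin (m + 1) → ℝ → ℝ) (v p : Fin (m + 1) → ℝ) : Prop where
  nonpos : p (Fin.last m) ≤ 0
  integrable : Integrable (fun x => Real.exp (linComb φ p x)) posVol
  le : ∀ q, q (Fin.last m) ≤ 0 → Integrable (fun x => Real.exp (linComb φ q x)) posVol →
    Real.log (∫ x, Real.exp (linComb φ p x) ∂posVol) + ∑ i, v i * (q i - p i) ≤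
      Real.log (∫ x, Real.exp (linComb φ q x) ∂posVol)

namespace IsDualMin

variable {φ : Fin (m + 1) → ℝ → ℝ} {v p : Fin (m + 1) → ℝ}

/-- The condition on e makes the partition function finite at p + e, hence by convexity on the whole
segment from p, even when pₖ = 0. -/
theorem directional (hφ : Observables φ) (h : IsDualMin φ v p) (e : Fin (m + 1) → ℝ)
    (he : p (Fin.last m) + e (Fin.last m) < 0) :
    Integrable (linComb φ e) (gibbs (linComb φ p)) ∧
      ∑ i, v i * e i ≤ ∫ x, linComb φ e x ∂(gibbs (linComb φ p)) := by
  refine integrable_and_le_integral_gibbs h.integrable ?_ fun t ht0 ht1 hi => ?_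
  · simp only [← linComb_add]
    exact hφ.integrable_exp_linComb he
  · simp only [← linComb_smul, ← linComb_add] at hi ⊢
    have hle : (p + t • e) (Fin.last m) ≤ 0 := by
      simp only [Pi.add_apply, Pi.smul_apply, smul_eq_mul]
      nlinarith [h.nonpos]
    have := h.le _ hle hi
    simp only [Pi.add_apply, Pi.smul_apply, smul_eq_mul, add_sub_cancel_left] at this
    rw [Finset.mul_sum]
    simpa only [mul_left_comm] using this

theorem integrable_observable (hφ : Observables φ) (h : IsDualMin φ v p) (i : Fin (m + 1)) :
    Integrable (φ i) (gibbs (linComb φ p)) := by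
  have hp := h.nonpos
  have hl : Integrable (φ (Fin.last m)) (gibbs (linComb φ p)) := by
    have := (h.directional hφ (Pi.single (Fin.last m) (-1)) (by simp; linarith)).1.neg
    refine this.congr (ae_of_all _ fun x => ?_)
    simp [linComb_single]
  by_cases hi : i = Fin.last m
  · exact hi ▸ hl
  have := (h.directional hφ (Pi.single i 1 + Pi.single (Fin.last m) (-1))
    (by simp [Ne.symm hi]; linarith)).1.add hl
  refine this.congr (ae_of_all _ fun x => ?_)
  simp [linComb_add, linComb_single]

theorem sum_nonneg (hφ : Observables φ) (h : IsDualMin φ v p) (e : Fin (m + 1) → ℝ)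
    (he : p (Fin.last m) + e (Fin.last m) < 0) :
    0 ≤ ∑ i, e i * (∫ x, φ i x ∂(gibbs (linComb φ p)) - v i) := by
  have := (h.directional hφ e he).2
  rw [integral_linComb (h.integrable_observable hφ)] at this
  simp only [mul_sub, Finset.sum_sub_distrib, mul_comm (e _) (v _)]
  linarith

/-- The direction s eᵢ - eₖ is allowed for every real s, and an affine function of s that stays
nonnegative has zero slope. -/
theorem integral_castSucc (hφ : Observables φ) (h : IsDualMin φ v p) (i : Fin m) :
    ∫ x, φ i.castSucc x ∂(gibbs (linComb φ p)) = v i.castSucc := by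
  have hp := h.nonpos
  set c := ∫ x, φ i.castSucc x ∂(gibbs (linComb φ p)) - v i.castSucc with hc
  set d := ∫ x, φ (Fin.last m) x ∂(gibbs (linComb φ p)) - v (Fin.last m) with hd
  have key : ∀ s : ℝ, 0 ≤ s * c - d := by
    intro s
    have := h.sum_nonneg hφ (Pi.single i.castSucc s + Pi.single (Fin.last m) (-1))
      (by simp [(Fin.castSucc_lt_last i).ne']; linarith)
    simp only [Pi.add_apply, add_mul, Finset.sum_add_distrib, Pi.single_apply, ite_mul, zero_mul,
      Finset.sum_ite_eq', Finset.mem_univ, if_true] at this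
    linarith
  by_contra hne
  have hc0 : c ≠ 0 := sub_ne_zero.2 hne
  -- At this s the affine function equals -1.
  have := key ((d - 1) / c)
  rw [div_mul_cancel₀ _ hc0] at this
  linarith

theorem integral_last_le (hφ : Observables φ) (h : IsDualMin φ v p) :
    ∫ x, φ (Fin.last m) x ∂(gibbs (linComb φ p)) ≤ v (Fin.last m) := by
  have hp := h.nonpos
  have := h.sum_nonneg hφ (Pi.single (Fin.last m) (-1)) (by simp; linarith)
  simp only [Pi.single_apply, ite_mul, zero_mul, Finset.sum_ite_eq', Finset.mem_univ,
    if_true] at this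
  linarith

/-- When pₖ < 0 there is room to move in the direction +eₖ as well, which gives the reverse
inequality. -/
theorem integral_last_eq (hφ : Observables φ) (h : IsDualMin φ v p) (hp : p (Fin.last m) < 0) :
    ∫ x, φ (Fin.last m) x ∂(gibbs (linComb φ p)) = v (Fin.last m) := by
  refine (h.integral_last_le hφ).antisymm ?_
  have := h.sum_nonneg hφ (Pi.single (Fin.last m) (-p (Fin.last m) / 2)) (by simp; linarith)
  simp only [Pi.single_apply, ite_mul, zero_mul, Finset.sum_ite_eq', Finset.mem_univ,
    if_true] at this
  nlinarith

end IsDualMin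

/-! ### Existence of a dual minimizer -/

section Existence

variable {φ : Fin (m + 1) → ℝ → ℝ}

/-- The exponential of the dual function. -/
def dualExp (φ : Fin (m + 1) → ℝ → ℝ) (a q : Fin (m + 1) → ℝ) : ℝ≥0∞ :=
  ∫⁻ x, ENNReal.ofReal (Real.exp (linComb φ q x - ∑ i, q i * a i)) ∂posVol

theorem dualExp_eq (a : Fin (m + 1) → ℝ) {q : Fin (m + 1) → ℝ}
    (hq : Integrable (fun x => Real.exp (linComb φ q x)) posVol) :
    dualExp φ a q = ENNReal.ofReal (Real.exp
      (Real.log (∫ x, Real.exp (linComb φ q x) ∂posVol) - ∑ i, q i * a i)) := by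
  unfold dualExp
  have hi : Integrable (fun x => Real.exp (linComb φ q x - ∑ i, q i * a i)) posVol := by
    simp only [Real.exp_sub]
    exact hq.div_const _
  rw [← ofReal_integral_eq_lintegral_ofReal hi (ae_of_all _ fun x => (Real.exp_pos _).le)]
  simp only [Real.exp_sub]
  rw [integral_div, Real.exp_log (integral_exp_pos hq)]

theorem integrable_of_dualExp_ne_top (hφ : Observables φ) {a q : Fin (m + 1) → ℝ}
    (hq : dualExp φ a q ≠ ∞) : Integrable (fun x => Real.exp (linComb φ q x)) posVol := by
  have hi : Integrable (fun x => Real.exp (linComb φ q x - ∑ i, q i * a i)) posVol := by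
    refine ⟨((hφ.aemeasurable_linComb q).sub_const _).exp.aestronglyMeasurable, ?_⟩
    rw [hasFiniteIntegral_iff_ofReal (ae_of_all _ fun x => (Real.exp_pos _).le)]
    exact hq.lt_top
  refine (hi.mul_const (Real.exp (∑ i, q i * a i))).congr (ae_of_all _ fun x => ?_)
  simp only [← Real.exp_add, sub_add_cancel]

/-- Fatou's lemma along `𝓝 q`. Working with the exponential in `ℝ≥0∞` covers the points where the
integral diverges. -/
theorem lowerSemicontinuous_dualExp (hφ : Observables φ) (a : Fin (m + 1) → ℝ) :
    LowerSemicontinuous (dualExp φ a) := by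
  rw [lowerSemicontinuous_iff_le_liminf]
  intro q
  have hc : ∀ x, Continuous fun r : Fin (m + 1) → ℝ =>
      ENNReal.ofReal (Real.exp (linComb φ r x - ∑ i, r i * a i)) := by
    intro x
    unfold linComb
    exact ENNReal.continuous_ofReal.comp (by fun_prop)
  calc dualExp φ a q = ∫⁻ x, liminf (fun r =>
        ENNReal.ofReal (Real.exp (linComb φ r x - ∑ i, r i * a i))) (𝓝 q) ∂posVol :=
        lintegral_congr fun x => ((hc x).tendsto q).liminf_eq.symm
    _ ≤ liminf (dualExp φ a) (𝓝 q) := lintegral_liminf_le' fun r =>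
        ((hφ.aemeasurable_linComb r).sub_const _).exp.ennreal_ofReal

theorem integrable_of_castSucc {μ : Measure ℝ} {v : Fin m → ℝ}
    (h : ∀ i : Fin m, HasMoment μ (φ i.castSucc) (v i)) (hl : Integrable (φ (Fin.last m)) μ)
    (i : Fin (m + 1)) : Integrable (φ i) μ := by
  induction i using Fin.lastCases with
  | last => exact hl
  | cast i => exact (h i).1

theorem exists_dualMin (hφ : Observables φ) {a : Fin (m + 1) → ℝ} (ha : a ∈ admissible φ) :
    ∃ p, IsDualMin φ a p := by
  obtain ⟨hint, hg⟩ := ha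
  set q₀ : Fin (m + 1) → ℝ := Pi.single (Fin.last m) (-1) with hq₀
  have hq₀i : Integrable (fun x => Real.exp (linComb φ q₀ x)) posVol :=
    hφ.integrable_exp_linComb (by simp [hq₀])
  set L := Real.log (∫ x, Real.exp (linComb φ q₀ x) ∂posVol) - ∑ i, q₀ i * a i with hL
  have hE₀ : dualExp φ a q₀ ≠ ∞ := by rw [dualExp_eq a hq₀i]; exact ENNReal.ofReal_ne_top
  let K : Set (Fin (m + 1) → ℝ) := {q | q (Fin.last m) ≤ 0 ∧ dualExp φ a q ≤ dualExp φ a q₀}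
  have hKi : ∀ q ∈ K, Integrable (fun x => Real.exp (linComb φ q x)) posVol := fun q hq =>
    integrable_of_dualExp_ne_top hφ (hq.2.trans_lt hE₀.lt_top).ne
  have hKL : ∀ q ∈ K,
      Real.log (∫ x, Real.exp (linComb φ q x) ∂posVol) - ∑ i, q i * a i ≤ L := by
    intro q hq
    have := hq.2
    rwa [dualExp_eq a (hKi q hq), dualExp_eq a hq₀i,
      ENNReal.ofReal_le_ofReal_iff (Real.exp_pos _).le, Real.exp_le_exp] at this
  -- On the sublevel set K, each finite-entropy test measure bounds from above a linear functional
  -- of q whose coefficients are its moments minus a.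
  have bound : ∀ μ : Measure ℝ, IsProbOnPos μ → diffEntropy μ ≠ ⊥ → ∀ v : Fin m → ℝ,
      (∀ i : Fin m, HasMoment μ (φ i.castSucc) (v i)) → Integrable (φ (Fin.last m)) μ →
      ∃ e : ℝ, ∀ q ∈ K, (∑ i : Fin m, q i.castSucc * (v i - a i.castSucc)) +
        q (Fin.last m) * (∫ x, φ (Fin.last m) x ∂μ - a (Fin.last m)) ≤ e := by
    intro μ hμ hent v hv hl
    obtain ⟨e, -, he⟩ := hφ.variational hμ hent (integrable_of_castSucc hv hl)
    refine ⟨L - e, fun q hq => ?_⟩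
    have h1 := (he q (hKi q hq)).1
    have h2 := hKL q hq
    have h3 : ∀ i : Fin m, ∫ x, φ i.castSucc x ∂μ = v i := fun i => (hv i).2
    rw [Fin.sum_univ_castSucc] at h1 h2
    simp only [h3] at h1
    simp only [mul_sub, Finset.sum_sub_distrib]
    linarith
  -- a bound on the last coordinate, then on the others
  have hlast : ∃ B, ∀ q ∈ K, |q (Fin.last m)| ≤ B := by
    obtain ⟨-, μ₁, hμ₁, hent₁, hv₁, hl₁⟩ := interior_subset hint
    -- As g₁ < aₖ, some test measure has the exact first moments and last moment t < aₖ; only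
    -- |qₖ|(aₖ - t) survives in the bound.
    obtain ⟨t, ⟨μ, hμ, hent, hv, hl, ht⟩, hta⟩ :=
      exists_lt_of_csInf_lt (s := {t | ∃ μ : Measure ℝ, IsProbOnPos μ ∧ diffEntropy μ ≠ ⊥ ∧
        (∀ i : Fin m, HasMoment μ (φ i.castSucc) (Fin.init a i)) ∧
        HasMoment μ (φ (Fin.last m)) t}) ⟨_, μ₁, hμ₁, hent₁, hv₁, hl₁, rfl⟩ hg
    obtain ⟨e, he⟩ := bound μ hμ hent _ hv hl
    refine ⟨e / (a (Fin.last m) - t), fun q hq => ?_⟩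
    have := he q hq
    simp only [Fin.init, sub_self, mul_zero, Finset.sum_const_zero, ht] at this
    rw [abs_of_nonpos hq.1, le_div_iff₀ (sub_pos.2 hta)]
    linarith
  obtain ⟨B, hB⟩ := hlast
  obtain ⟨δ, hδ, hball⟩ := Metric.isOpen_iff.1 isOpen_interior _ hint
  have hside : ∀ (i : Fin m) (s : ℝ), |s| < δ → ∃ C, ∀ q ∈ K, s * q i.castSucc ≤ C := by
    intro i s hs
    -- An interior point can be shifted by ±s in each coordinate, which bounds qᵢ on both sides once
    -- qₖ is bounded.
    have hmem : Fin.init a + Pi.single i s ∈ momentSet φ := by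
      refine interior_subset (hball ?_)
      rw [mem_ball_iff_norm, add_sub_cancel_left, Pi.norm_single]
      exact hs
    obtain ⟨-, μ, hμ, hent, hv, hl⟩ := hmem
    obtain ⟨e, he⟩ := bound μ hμ hent _ hv hl
    refine ⟨e + B * |∫ x, φ (Fin.last m) x ∂μ - a (Fin.last m)|, fun q hq => ?_⟩
    have h1 := he q hq
    have h2 : ∑ j : Fin m, q j.castSucc * ((Fin.init a + Pi.single i s : Fin m → ℝ) j -
        a j.castSucc) = s * q i.castSucc := by
      simp [Fin.init, Pi.single_apply, mul_comm]
    rw [h2] at h1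
    have h3 : |q (Fin.last m) * (∫ x, φ (Fin.last m) x ∂μ - a (Fin.last m))| ≤
        B * |∫ x, φ (Fin.last m) x ∂μ - a (Fin.last m)| := by
      rw [abs_mul]
      exact mul_le_mul_of_nonneg_right (hB q hq) (abs_nonneg _)
    have := neg_le_of_abs_le h3
    linarith
  have hcoord : ∀ i : Fin (m + 1), ∃ C, ∀ q ∈ K, |q i| ≤ C := by
    intro i
    induction i using Fin.lastCases with
    | last => exact ⟨B, hB⟩
    | cast i =>
      obtain ⟨C₁, h₁⟩ := hside i (δ / 2) (by rw [abs_of_pos (half_pos hδ)]; linarith)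
      obtain ⟨C₂, h₂⟩ := hside i (-(δ / 2))
        (by rw [abs_neg, abs_of_pos (half_pos hδ)]; linarith)
      refine ⟨max C₁ C₂ / (δ / 2), fun q hq => ?_⟩
      rw [le_div_iff₀ (half_pos hδ)]
      rcases abs_cases (q i.castSucc) with ⟨h, -⟩ | ⟨h, -⟩ <;> rw [h]
      · exact le_max_of_le_left (by linarith [h₁ q hq])
      · exact le_max_of_le_right (by linarith [h₂ q hq])
  choose C hC using hcoord
  have hlsc := lowerSemicontinuous_dualExp hφ a
  have hclosed : IsClosed K := by
    refine (isClosed_le (continuous_apply _) continuous_const).inter ?_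
    exact lowerSemicontinuous_iff_isClosed_preimage.1 hlsc (dualExp φ a q₀)
  have hcompact : IsCompact K := by
    refine IsCompact.of_isClosed_subset (isCompact_univ_pi fun i => isCompact_Icc (a := -C i)
      (b := C i)) hclosed fun q hq i _ => abs_le.1 (hC i q hq)
  have hq₀K : q₀ ∈ K := ⟨by simp [hq₀], le_rfl⟩
  obtain ⟨p, hpK, hp⟩ := (hlsc.lowerSemicontinuousOn K).exists_isMinOn ⟨q₀, hq₀K⟩ hcompact
  refine ⟨p, hpK.1, hKi p hpK, fun q hq hqi => ?_⟩
  -- Outside K the dual function exceeds its value at q₀ ∈ K, so the minimum over K is the minimum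
  -- over the half-space.
  have hle : dualExp φ a p ≤ dualExp φ a q := by
    by_cases hqK : q ∈ K
    · exact hp hqK
    · have : dualExp φ a q₀ < dualExp φ a q := by
        by_contra hcon
        exact hqK ⟨hq, not_lt.1 hcon⟩
      exact hpK.2.trans this.le
  rw [dualExp_eq a (hKi p hpK), dualExp_eq a hqi,
    ENNReal.ofReal_le_ofReal_iff (Real.exp_pos _).le, Real.exp_le_exp] at hle
  simp only [mul_comm (a _), sub_mul, Finset.sum_sub_distrib]
  linarith

end Existence

/-! ### From dual minimizers to entropy maximizers -/

section Maximizer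

variable {φ : Fin (m + 1) → ℝ → ℝ} {v p : Fin (m + 1) → ℝ}

theorem diffEntropy_gibbs_linComb
    (hexp : Integrable (fun x => Real.exp (linComb φ p x)) posVol)
    (hi : ∀ i, Integrable (φ i) (gibbs (linComb φ p))) :
    diffEntropy (gibbs (linComb φ p)) = ((Real.log (∫ x, Real.exp (linComb φ p x) ∂posVol) -
      ∑ i, p i * ∫ x, φ i x ∂(gibbs (linComb φ p)) : ℝ) : EReal) := by
  rw [diffEntropy_gibbs hexp (integrable_linComb hi p), integral_linComb hi]

/-- The variational principle at q, tested on the Gibbs measure of p, whose entropy is explicit: its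
moments are a subgradient at p. -/
theorem Observables.log_integral_add_le (hφ : Observables φ)
    (hexp : Integrable (fun x => Real.exp (linComb φ p x)) posVol)
    (hi : ∀ i, Integrable (φ i) (gibbs (linComb φ p))) {q : Fin (m + 1) → ℝ}
    (hq : Integrable (fun x => Real.exp (linComb φ q x)) posVol) :
    Real.log (∫ x, Real.exp (linComb φ p x) ∂posVol) +
        ∑ i, (∫ x, φ i x ∂(gibbs (linComb φ p))) * (q i - p i) ≤
      Real.log (∫ x, Real.exp (linComb φ q x) ∂posVol) := by
  have hent := diffEntropy_gibbs_linComb hexp hi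
  obtain ⟨e, he, H⟩ := hφ.variational (isProbOnPos_gibbs hexp)
    (by rw [hent]; exact EReal.coe_ne_bot _) hi
  have h1 := (H q hq).1
  rw [hent, EReal.coe_eq_coe_iff] at he
  rw [← he] at h1
  simp only [mul_comm (∫ x, φ _ x ∂_), sub_mul, Finset.sum_sub_distrib]
  linarith

theorem isDualMin_of_last_eq_zero (hφ : Observables φ) (hp : p (Fin.last m) = 0)
    (hexp : Integrable (fun x => Real.exp (linComb φ p x)) posVol)
    (hi : ∀ i, Integrable (φ i) (gibbs (linComb φ p)))
    (hm : ∀ i : Fin m, ∫ x, φ i.castSucc x ∂(gibbs (linComb φ p)) = v i.castSucc)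
    (hl : ∫ x, φ (Fin.last m) x ∂(gibbs (linComb φ p)) ≤ v (Fin.last m)) :
    IsDualMin φ v p := by
  refine ⟨hp.le, hexp, fun q hq hqi => le_trans ?_ (hφ.log_integral_add_le hexp hi hqi)⟩
  rw [Fin.sum_univ_castSucc, Fin.sum_univ_castSucc]
  simp only [hm, hp]
  nlinarith

namespace IsDualMin

/-- Complementary slackness: either pₖ = 0 or the last constraint is tight. -/
theorem sum_mul_integral (hφ : Observables φ) (h : IsDualMin φ v p) :
    ∑ i, p i * ∫ x, φ i x ∂(gibbs (linComb φ p)) = ∑ i, p i * v i := by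
  rw [Fin.sum_univ_castSucc, Fin.sum_univ_castSucc]
  simp only [h.integral_castSucc hφ]
  rcases h.nonpos.eq_or_lt with h0 | h0
  · simp [h0]
  · rw [h.integral_last_eq hφ h0]

theorem mem_relaxedSet (hφ : Observables φ) (h : IsDualMin φ v p) :
    gibbs (linComb φ p) ∈ relaxedSet φ v :=
  ⟨isProbOnPos_gibbs h.integrable,
    fun i => ⟨h.integrable_observable hφ _, h.integral_castSucc hφ i⟩,
    h.integrable_observable hφ _, h.integral_last_le hφ⟩

theorem diffEntropy_eq (hφ : Observables φ) (h : IsDualMin φ v p) :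
    diffEntropy (gibbs (linComb φ p)) =
      ((Real.log (∫ x, Real.exp (linComb φ p x) ∂posVol) - ∑ i, p i * v i : ℝ) : EReal) := by
  rw [diffEntropy_gibbs_linComb h.integrable (h.integrable_observable hφ), h.sum_mul_integral hφ]

theorem diffEntropy_le (hφ : Observables φ) (h : IsDualMin φ v p) {ν : Measure ℝ}
    (hν : ν ∈ relaxedSet φ v) :
    diffEntropy ν ≤ diffEntropy (gibbs (linComb φ p)) ∧
      (diffEntropy (gibbs (linComb φ p)) ≤ diffEntropy ν → ν = gibbs (linComb φ p)) := by
  obtain ⟨hprob, hmom, hl, hle⟩ := hν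
  have hG := h.diffEntropy_eq hφ
  by_cases hbot : diffEntropy ν = ⊥
  · rw [hbot, hG]
    exact ⟨bot_le, fun hcon => absurd (le_bot_iff.1 hcon) (EReal.coe_ne_bot _)⟩
  obtain ⟨e, he, H⟩ := hφ.variational hprob hbot (integrable_of_castSucc hmom hl)
  obtain ⟨h1, h2⟩ := H p h.integrable
  -- The inequality constraint and pₖ ≤ 0 push in the same direction.
  have hslack : ∑ i, p i * v i ≤ ∑ i, p i * ∫ x, φ i x ∂ν := by
    rw [Fin.sum_univ_castSucc, Fin.sum_univ_castSucc]
    simp only [fun i => (hmom i).2]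
    nlinarith [mul_le_mul_of_nonpos_left hle h.nonpos]
  rw [hG, he, EReal.coe_le_coe_iff, EReal.coe_le_coe_iff]
  exact ⟨by linarith, fun h3 => h2 (by linarith)⟩

theorem isEntropyMaximizer (hφ : Observables φ) (h : IsDualMin φ v p) :
    IsEntropyMaximizer φ v (gibbs (linComb φ p)) :=
  ⟨h.mem_relaxedSet hφ, fun _ hν => (h.diffEntropy_le hφ hν).1⟩

theorem eq_gibbs (hφ : Observables φ) (h : IsDualMin φ v p) {ν : Measure ℝ}
    (hν : IsEntropyMaximizer φ v ν) : ν = gibbs (linComb φ p) :=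
  (h.diffEntropy_le hφ hν.1).2 (hν.2 _ (h.mem_relaxedSet hφ))

end IsDualMin

end Maximizer

/-! ### The subdifferential of H and the function g₂ -/

section Subdifferential

variable {φ : Fin (m + 1) → ℝ → ℝ}

theorem Observables.integrable_exp_neg (hφ : Observables φ) {i : Fin (m + 1)} :
    Integrable (fun x => Real.exp (-φ i x)) posVol :=
  (hφ.integrable i 1 one_pos).congr (ae_of_all _ fun x => by simp)

theorem last_ne_zero_of_one_le (hm : 1 ≤ m) : Fin.last m ≠ 0 :=
  Fin.ne_of_gt (Nat.lt_of_succ_le hm)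

/-- The density of λ shifts the exponent by -φ₁, so H at q corresponds to the Lebesgue exponent q -
e₁. -/
theorem logMGF_eq_log_lintegral (hφ : Observables φ) (q : Fin (m + 1) → ℝ) :
    logMGF φ q = ENNReal.log (∫⁻ x, ENNReal.ofReal
      (Real.exp (linComb φ (q - Pi.single 0 1) x) / ∫ y, Real.exp (-φ 0 y) ∂posVol) ∂posVol) := by
  have hZ : 0 < ∫ y, Real.exp (-φ 0 y) ∂posVol :=
    integral_exp_pos hφ.integrable_exp_neg
  rw [logMGF, refMeasure, gibbs, lintegral_tilted]
  congr 1
  refine lintegral_congr fun x => ?_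
  rw [← ENNReal.ofReal_mul (div_nonneg (Real.exp_pos _).le hZ.le), div_mul_eq_mul_div,
    ← Real.exp_add]
  have : linComb φ (q - Pi.single 0 1) x = -φ 0 x + ∑ i, q i * φ i x := by
    have h1 := linComb_add φ (q - Pi.single 0 1) (Pi.single 0 1) x
    rw [sub_add_cancel, linComb_single, one_mul] at h1
    unfold linComb at h1 ⊢
    linarith
  rw [this]

theorem logMGF_of_integrable (hφ : Observables φ) {q : Fin (m + 1) → ℝ}
    (hq : Integrable (fun x => Real.exp (linComb φ (q - Pi.single 0 1) x)) posVol) :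
    logMGF φ q = ((Real.log (∫ x, Real.exp (linComb φ (q - Pi.single 0 1) x) ∂posVol) -
      Real.log (∫ y, Real.exp (-φ 0 y) ∂posVol) : ℝ) : EReal) := by
  have hZ : 0 < ∫ y, Real.exp (-φ 0 y) ∂posVol :=
    integral_exp_pos hφ.integrable_exp_neg
  have hZq := integral_exp_pos hq
  rw [logMGF_eq_log_lintegral hφ, ← ofReal_integral_eq_lintegral_ofReal (hq.div_const _)
    (ae_of_all _ fun x => div_nonneg (Real.exp_pos _).le hZ.le), integral_div,
    ENNReal.log_ofReal_of_pos (div_pos hZq hZ), Real.log_div hZq.ne' hZ.ne']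

theorem logMGF_of_not_integrable (hφ : Observables φ) {q : Fin (m + 1) → ℝ}
    (hq : ¬ Integrable (fun x => Real.exp (linComb φ (q - Pi.single 0 1) x)) posVol) :
    logMGF φ q = ⊤ := by
  have hZ : 0 < ∫ y, Real.exp (-φ 0 y) ∂posVol :=
    integral_exp_pos hφ.integrable_exp_neg
  rw [logMGF_eq_log_lintegral hφ, ENNReal.log_eq_top_iff]
  by_contra hne
  apply hq
  have hi : Integrable (fun x => Real.exp (linComb φ (q - Pi.single 0 1) x) /
      ∫ y, Real.exp (-φ 0 y) ∂posVol) posVol := by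
    refine ⟨((hφ.aemeasurable_linComb _).exp.div_const _).aestronglyMeasurable, ?_⟩
    rw [hasFiniteIntegral_iff_ofReal
      (ae_of_all _ fun x => div_nonneg (Real.exp_pos _).le hZ.le)]
    exact lt_top_iff_ne_top.2 hne
  refine (hi.mul_const (∫ y, Real.exp (-φ 0 y) ∂posVol)).congr (ae_of_all _ fun x => ?_)
  simp only [div_mul_cancel₀ _ hZ.ne']

/-- The exponent, relative to Lebesgue measure, of `e^{∑ qᵢ φᵢ} dλ` with `qₖ = 0`. -/
def tilt₀ (q : Fin m → ℝ) : Fin (m + 1) → ℝ := Fin.snoc q 0 - Pi.single 0 1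

/-- Here k ≥ 2 matters: the shift by e₁ must not touch the last coordinate. -/
theorem tilt₀_last (hm : 1 ≤ m) (q : Fin m → ℝ) : tilt₀ q (Fin.last m) = 0 := by
  simp [tilt₀, last_ne_zero_of_one_le hm]

/-- Up to the shift by e₁ and a constant, the subgradient inequality restricted to qₖ ≤ 0 is dual
minimality. -/
theorem isDualMin_of_mem_subdiff₀ (hm : 1 ≤ m) (hφ : Observables φ) {q : Fin m → ℝ}
    {w : Fin (m + 1) → ℝ} (hw : w ∈ subdiff₀ φ q) : IsDualMin φ w (tilt₀ q) := by
  have hint : Integrable (fun x => Real.exp (linComb φ (tilt₀ q) x)) posVol := by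
    by_contra hcon
    -- If H were infinite at the base point, the subgradient inequality would make it infinite at
    -- -eₖ, where it is finite.
    have h1 := hw (Pi.single (Fin.last m) (-1))
    rw [logMGF_of_not_integrable hφ hcon,
      logMGF_of_integrable hφ (hφ.integrable_exp_linComb (by
        simp [last_ne_zero_of_one_le hm])),
      EReal.top_add_coe] at h1
    exact EReal.coe_ne_top _ (top_le_iff.1 h1)
  refine ⟨(tilt₀_last hm q).le, hint, fun r _ hr => ?_⟩
  have h1 := hw (r + Pi.single 0 1)
  have hr' : r + Pi.single 0 1 - Pi.single 0 1 = r := add_sub_cancel_right _ _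
  rw [logMGF_of_integrable hφ hint, logMGF_of_integrable hφ (by rwa [hr']), hr',
    ← EReal.coe_add, EReal.coe_le_coe_iff] at h1
  have h2 : ∀ i, r i - tilt₀ q i =
      (r + Pi.single 0 1 : Fin (m + 1) → ℝ) i - (Fin.snoc q 0 : Fin (m + 1) → ℝ) i :=
    fun i => by simp only [tilt₀, Pi.add_apply, Pi.sub_apply]; ring
  simp only [h2]
  unfold tilt₀
  linarith

theorem moments_mem_subdiff₀ (hφ : Observables φ) {q : Fin m → ℝ}
    (hexp : Integrable (fun x => Real.exp (linComb φ (tilt₀ q) x)) posVol)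
    (hi : ∀ i, Integrable (φ i) (gibbs (linComb φ (tilt₀ q)))) :
    (fun i => ∫ x, φ i x ∂(gibbs (linComb φ (tilt₀ q)))) ∈ subdiff₀ φ q := by
  intro r
  by_cases hr : Integrable (fun x => Real.exp (linComb φ (r - Pi.single 0 1) x)) posVol
  · have h1 := hφ.log_integral_add_le hexp hi hr
    rw [logMGF_of_integrable hφ hexp, logMGF_of_integrable hφ hr, ← EReal.coe_add,
      EReal.coe_le_coe_iff]
    have h2 : ∀ i, (r - Pi.single 0 1 : Fin (m + 1) → ℝ) i - tilt₀ q i =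
        r i - (Fin.snoc q 0 : Fin (m + 1) → ℝ) i := fun i => by
      simp only [tilt₀, Pi.sub_apply]; ring
    simp only [h2] at h1
    unfold tilt₀ at h1 ⊢
    linarith
  · rw [logMGF_of_not_integrable hφ hr]
    exact le_top

/-- The Gibbs measure behind the value of `g₂`. -/
theorem exists_gibbs_of_mem_S₁ (hm : 1 ≤ m) (hφ : Observables φ) {v : Fin m → ℝ}
    (hv : v ∈ S₁ φ) :
    ∃ p : Fin (m + 1) → ℝ, p (Fin.last m) = 0 ∧
      Integrable (fun x => Real.exp (linComb φ p x)) posVol ∧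
      (∀ i, Integrable (φ i) (gibbs (linComb φ p))) ∧
      (∀ i : Fin m, ∫ x, φ i.castSucc x ∂(gibbs (linComb φ p)) = v i) ∧
      g₂ φ v = ∫ x, φ (Fin.last m) x ∂(gibbs (linComb φ p)) := by
  obtain ⟨w, hw, hwv⟩ := Classical.choose_spec hv.2
  have hdual := isDualMin_of_mem_subdiff₀ hm hφ hw
  refine ⟨_, tilt₀_last hm _, hdual.integrable, hdual.integrable_observable hφ, fun i => ?_, ?_⟩
  · rw [hdual.integral_castSucc hφ, ← hwv, Fin.init]
  · rw [g₂, dif_pos hv]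
    -- The infimum is attained: the Gibbs moments are themselves a subgradient, and every other
    -- subgradient at this point has last coordinate at least the last Gibbs moment.
    refine IsLeast.csInf_eq ⟨⟨_, moments_mem_subdiff₀ hφ hdual.integrable
      (hdual.integrable_observable hφ), rfl⟩, ?_⟩
    rintro _ ⟨w', hw', rfl⟩
    exact (isDualMin_of_mem_subdiff₀ hm hφ hw').integral_last_le hφ

/-- With the larger of the two last moments as common bound, both exponents are dual minimizers for
one problem, whose maximizer is unique. This identifies the exponent chosen in `g₂` with any other,
at the level of measures. -/
theorem gibbs_eq_of_integral_eq (hφ : Observables φ) {p q : Fin (m + 1) → ℝ}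
    (hp : p (Fin.last m) = 0) (hq : q (Fin.last m) = 0)
    (hpe : Integrable (fun x => Real.exp (linComb φ p x)) posVol)
    (hqe : Integrable (fun x => Real.exp (linComb φ q x)) posVol)
    (hpi : ∀ i, Integrable (φ i) (gibbs (linComb φ p)))
    (hqi : ∀ i, Integrable (φ i) (gibbs (linComb φ q)))
    (h : ∀ i : Fin m, ∫ x, φ i.castSucc x ∂(gibbs (linComb φ p)) =
      ∫ x, φ i.castSucc x ∂(gibbs (linComb φ q))) :
    gibbs (linComb φ p) = gibbs (linComb φ q) := by
  set v : Fin (m + 1) → ℝ := Fin.snoc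
    (fun i : Fin m => ∫ x, φ i.castSucc x ∂(gibbs (linComb φ q)))
    (max (∫ x, φ (Fin.last m) x ∂(gibbs (linComb φ p)))
      (∫ x, φ (Fin.last m) x ∂(gibbs (linComb φ q)))) with hv
  have h1 : IsDualMin φ v p := isDualMin_of_last_eq_zero hφ hp hpe hpi
    (fun i => by simp [hv, h]) (by simp [hv])
  have h2 : IsDualMin φ v q := isDualMin_of_last_eq_zero hφ hq hqe hqi
    (fun i => by simp [hv]) (by simp [hv])
  exact h2.eq_gibbs hφ (h1.isEntropyMaximizer hφ)

theorem linComb_of_last_eq_zero {p : Fin (m + 1) → ℝ} (hp : p (Fin.last m) = 0) :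
    linComb φ p = fun x => ∑ i : Fin m, p i.castSucc * φ i.castSucc x := by
  ext x
  simp [linComb, Fin.sum_univ_castSucc, hp]

end Subdifferential

end

/-! ### The main theorem -/

theorem mainTheorem10 (m : ℕ) (hm : 1 ≤ m) (φ : Fin (m + 1) → ℝ → ℝ) (hφ : Observables φ)
    (a : Fin (m + 1) → ℝ) (ha : a ∈ admissible φ) :
    (∃! μ : Measure ℝ, IsEntropyMaximizer φ a μ) ∧
    ∀ μ : Measure ℝ, IsEntropyMaximizer φ a μ →
      ((Fin.init a ∈ S₁ φ ∧ g₂ φ (Fin.init a) ≤ a (Fin.last m)) →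
        ∃ p : Fin m → ℝ,
          IntegrableOn (fun x => Real.exp (∑ i, p i * φ i.castSucc x)) (Ioi 0) ∧
          μ = gibbs (fun x => ∑ i, p i * φ i.castSucc x) ∧
          ∀ i : Fin m, HasMoment μ (φ i.castSucc) (a i.castSucc)) ∧
      ((Fin.init a ∈ S₂ φ ∨ (Fin.init a ∈ S₁ φ ∧ a (Fin.last m) < g₂ φ (Fin.init a))) →
        ∃ p : Fin (m + 1) → ℝ,
          p (Fin.last m) < 0 ∧
          IntegrableOn (fun x => Real.exp (∑ i, p i * φ i x)) (Ioi 0) ∧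
          μ = gibbs (fun x => ∑ i, p i * φ i x) ∧
          ∀ i, HasMoment μ (φ i) (a i)) := by
  obtain ⟨p, hp⟩ := exists_dualMin hφ ha
  refine ⟨⟨_, hp.isEntropyMaximizer hφ, fun ν hν => hp.eq_gibbs hφ hν⟩, fun μ hμ => ⟨?_, ?_⟩⟩
  · rintro ⟨hS, hle⟩
    obtain ⟨q, hq, hqe, hqi, hqm, hqg⟩ := exists_gibbs_of_mem_S₁ hm hφ hS
    have hdual : IsDualMin φ a q := isDualMin_of_last_eq_zero hφ hq hqe hqi hqm (hqg ▸ hle)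
    have hlin := linComb_of_last_eq_zero (φ := φ) hq
    refine ⟨fun i => q i.castSucc, ?_, ?_, hμ.1.2.1⟩
    · have := hqe
      rw [hlin] at this
      exact this
    · rw [← hlin]
      exact hdual.eq_gibbs hφ hμ
  · intro hcase
    have hμp := hp.eq_gibbs hφ hμ
    rcases hp.nonpos.lt_or_eq with hneg | hzero
    · refine ⟨p, hneg, hp.integrable, hμp, fun i => ?_⟩
      subst hμp
      refine ⟨hp.integrable_observable hφ i, ?_⟩
      induction i using Fin.lastCases with
      | last => exact hp.integral_last_eq hφ hneg
      | cast i => exact hp.integral_castSucc hφ i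
    -- If pₖ = 0, the Gibbs moments put (a₁, …, aₖ₋₁) in 𝒮₁ and the last moment, at most aₖ, equals
    -- g₂; both alternatives of case (2) fail.
    · exfalso
      have htilt : tilt₀ (Fin.init (p + Pi.single 0 1)) = p := by
        have hlast : (p + Pi.single 0 1 : Fin (m + 1) → ℝ) (Fin.last m) = 0 := by
          simp [hzero, last_ne_zero_of_one_le hm]
        have := Fin.snoc_init_self (p + Pi.single 0 1 : Fin (m + 1) → ℝ)
        rw [hlast] at this
        rw [tilt₀, this, add_sub_cancel_right]
      have hS : Fin.init a ∈ S₁ φ := by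
        refine ⟨ha.1, Fin.init (p + Pi.single 0 1), _, moments_mem_subdiff₀ hφ ?_ ?_, ?_⟩
        · rw [htilt]
          exact hp.integrable
        · rw [htilt]
          exact hp.integrable_observable hφ
        · rw [htilt]
          exact funext fun i => hp.integral_castSucc hφ i
      rcases hcase with h2 | ⟨-, hlt⟩
      · exact h2.2 hS
      · obtain ⟨q, hq, hqe, hqi, hqm, hqg⟩ := exists_gibbs_of_mem_S₁ hm hφ hS
        have heq := gibbs_eq_of_integral_eq hφ hzero hq hp.integrable hqe
          (hp.integrable_observable hφ) hqi
          fun i => (hp.integral_castSucc hφ i).trans (hqm i).symm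
        rw [hqg, ← heq] at hlt
        exact absurd (hp.integral_last_le hφ) (not_le.2 hlt)
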